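/- Let $M$ be a Riemann surface, i.e. a smooth $2$-dimensional manifold with a smooth bundle map $J:TM\to TM$, $J^2=-I$; for a $1$-form $\omega$ on $M$ put $*\omega:=\omega\circ J$. Regard $\mathbb{H}^2$ as a right quaternionic vector space, let $\mathrm{End}(\mathbb{H}^2)$ be its quaternionic linear endomorphisms, $\mathcal{Z}=\{S\in\mathrm{End}(\mathbb{H}^2)\mid S^2=-I\}$, and $\langle A,B\rangle=\frac18\,\mathrm{tr}_{\mathbb{R}}(AB)$. Let $L\subset H=M\times\mathbb{H}^2$ be a smooth quaternionic line subbundle, with derivative $\delta\in\Omega^1(\mathrm{Hom}(L,H/L))$ defined by $\delta_p(X)\psi(p)=d_p\psi(X)\bmod L_p$ for smooth local sections $\psi$ of $L$. Suppose that $L$ is an immersed holomorphic curve in $\mathbb{H}P^1$: each $\delta_p$ is injective on $T_pM$, and there is a smooth quaternionic linear bundle endomorphism $\mathcal{J}$ of $L$ with $\mathcal{J}^2=-I$ and $*\delta=\delta\mathcal{J}$. Let $S:M\to\mathcal{Z}$ be the mean curvature sphere of $L$, i.e. the smooth map $S:M\to\mathcal{Z}$ such that $$SL=L,\qquad dS\,L\subset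 L,\qquad *\delta=\delta\circ S=S\circ\delta,\qquad Q|_L=0,\quad\text{where } Q=\tfrac14(S\,dS-*dS)$$ (in $S\circ\delta$, $S$ denotes the endomorphism induced on $H/L$). Then $S$ is conformal with respect to the trace form: for all $p\in M$ and $X\in T_pM$, $$\langle dS(X),dS(X)\rangle=\langle *dS(X),*dS(X)\rangle,\qquad \langle dS(X),*dS(X)\rangle=0 .$$ -/

import Mathlib

open scoped Quaternion Manifold ContDiff Topology

noncomputable section

namespace QuaternionicCurve

/-- The space `ℍ²`. Its quaternionic (right) scalar multiplication `v λ` is the action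
`MulOpposite.op λ • v` of the opposite algebra `ℍᵐᵒᵖ`. -/
abbrev H2 : Type := Fin 2 → ℍ[ℝ]

/-- `End(ℍ²)`: the quaternionic linear endomorphisms of the right vector space `ℍ²`. -/
abbrev EndH2 : Type := Module.End (ℍ[ℝ])ᵐᵒᵖ H2

/-- The inclusion of `End(ℍ²)` into the (normed) space of real endomorphisms of `ℍ²`. -/
def toReal (A : EndH2) : H2 →L[ℝ] H2 :=
  LinearMap.toContinuousLinearMap (A.restrictScalars ℝ)

/-- The set `𝒵 = {S ∈ End(ℍ²) | S² = -I}` of oriented 2-spheres in `ℍP¹`. -/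
def Z : Set EndH2 := {S | S * S = -1}

/-- The trace form `⟨A, B⟩ = (1/8) tr_ℝ (A B)`. -/
def traceForm (A B : H2 →L[ℝ] H2) : ℝ :=
  (1 / 8 : ℝ) * LinearMap.trace ℝ H2 ((A.comp B : H2 →L[ℝ] H2) : H2 →ₗ[ℝ] H2)

section Surface

variable {M : Type*} [TopologicalSpace M] [ChartedSpace (EuclideanSpace ℝ (Fin 2)) M]

variable (M) in
/-- A complex structure on a surface: a smooth bundle map `J : TM → TM` with `J² = -I`.
A Riemann surface is a smooth 2-dimensional manifold with such a structure. -/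
structure ComplexStructure [IsManifold (𝓡 2) ∞ M] where
  J : (p : M) → TangentSpace (𝓡 2) p →L[ℝ] TangentSpace (𝓡 2) p
  sq : ∀ p X, J p (J p X) = -X
  smooth : ContMDiff (𝓡 2).tangent (𝓡 2).tangent ∞
    (fun v : TangentBundle (𝓡 2) M => (⟨v.proj, J v.proj v.snd⟩ : TangentBundle (𝓡 2) M))

variable (M) in
/-- A smooth quaternionic line subbundle `L` of the trivial bundle `H = M × ℍ²`. -/
structure LineSubbundle where
  fiber : M → Submodule (ℍ[ℝ])ᵐᵒᵖ H2
  exists_frame : ∀ p, ∃ U : Set M, IsOpen U ∧ p ∈ U ∧ ∃ φ : M → H2,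
    ContMDiffOn (𝓡 2) 𝓘(ℝ, H2) ∞ φ U ∧
      ∀ q ∈ U, φ q ≠ 0 ∧ fiber q = Submodule.span (ℍ[ℝ])ᵐᵒᵖ {φ q}

namespace LineSubbundle

variable (L : LineSubbundle M)

/-- A smooth local frame of `L` near `p`. -/
def frame (p : M) : M → H2 := (L.exists_frame p).choose_spec.2.2.choose

theorem frame_spec (p : M) : ∃ U : Set M, IsOpen U ∧ p ∈ U ∧
    ContMDiffOn (𝓡 2) 𝓘(ℝ, H2) ∞ (L.frame p) U ∧
      ∀ q ∈ U, L.frame p q ≠ 0 ∧ L.fiber q = Submodule.span (ℍ[ℝ])ᵐᵒᵖ {L.frame p q} :=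
  ⟨_, (L.exists_frame p).choose_spec.1, (L.exists_frame p).choose_spec.2.1,
    (L.exists_frame p).choose_spec.2.2.choose_spec⟩

theorem frame_ne (p : M) : L.frame p p ≠ 0 := by
  obtain ⟨U, -, hp, -, h⟩ := L.frame_spec p
  exact (h p hp).1

theorem fiber_eq (p : M) : L.fiber p = Submodule.span (ℍ[ℝ])ᵐᵒᵖ {L.frame p p} := by
  obtain ⟨U, -, hp, -, h⟩ := L.frame_spec p
  exact (h p hp).2

/-- The quaternionic linear coordinate on `L_p` defined by the frame. -/
def coord (p : M) : L.fiber p →ₗ[(ℍ[ℝ])ᵐᵒᵖ] (ℍ[ℝ])ᵐᵒᵖ :=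
  (LinearEquiv.toSpanNonzeroSingleton (ℍ[ℝ])ᵐᵒᵖ H2 (L.frame p p) (L.frame_ne p)).symm.toLinearMap
    ∘ₗ (LinearEquiv.ofEq _ _ (L.fiber_eq p)).toLinearMap

/-- The derivative `δ ∈ Ω¹(Hom(L, H/L))` of `L`. It is the quaternionic linear map with
`δ_p(X) φ(p) = d_pφ(X) mod L_p` for the frame `φ`; by `delta_apply` below,
`δ_p(X) ψ(p) = d_pψ(X) mod L_p` then holds for every local section `ψ` of `L`. -/
def delta (p : M) :
    TangentSpace (𝓡 2) p →ₗ[ℝ] (L.fiber p →ₗ[(ℍ[ℝ])ᵐᵒᵖ] (H2 ⧸ L.fiber p)) where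
  toFun X := LinearMap.toSpanSingleton (ℍ[ℝ])ᵐᵒᵖ (H2 ⧸ L.fiber p)
    ((L.fiber p).mkQ (mvfderiv (𝓡 2) (L.frame p) p X)) ∘ₗ L.coord p
  map_add' X Y := by
    ext v
    simp
  map_smul' r X := by
    ext v
    have h : (L.fiber p).mkQ (r • mvfderiv (𝓡 2) (L.frame p) p X)
      = r • (L.fiber p).mkQ (mvfderiv (𝓡 2) (L.frame p) p X) := rfl
    simp only [map_smul, h, LinearMap.comp_apply, LinearMap.toSpanSingleton_apply,
      LinearMap.smul_apply, RingHom.id_apply]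
    rw [smul_comm]

theorem delta_apply (p : M) (X : TangentSpace (𝓡 2) p) (ψ : M → H2)
    (hψ : MDifferentiableAt (𝓡 2) 𝓘(ℝ, H2) ψ p) (hL : ∀ᶠ q in 𝓝 p, ψ q ∈ L.fiber q) :
    L.delta p X ⟨ψ p, hL.self_of_nhds⟩ = (L.fiber p).mkQ (mvfderiv (𝓡 2) ψ p X) := by
  obtain ⟨U, hU, hp, hφ, hspan⟩ := L.frame_spec p
  have hφd : MDifferentiableAt (𝓡 2) 𝓘(ℝ, H2) (L.frame p) p :=
    (hφ.contMDiffAt (hU.mem_nhds hp)).mdifferentiableAt (by simp)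
  obtain ⟨i, hi⟩ : ∃ i, L.frame p p i ≠ 0 := Function.ne_iff.mp (L.frame_ne p)
  have hev : ∀ k, Differentiable ℝ (fun v : H2 => v k) := fun k => by fun_prop
  have hφi : ∀ k, MDifferentiableAt (𝓡 2) 𝓘(ℝ, ℍ[ℝ]) (fun q => L.frame p q k) p := fun k =>
    (hev k).comp_mdifferentiableAt hφd
  have hψi : ∀ k, MDifferentiableAt (𝓡 2) 𝓘(ℝ, ℍ[ℝ]) (fun q => ψ q k) p := fun k =>
    (hev k).comp_mdifferentiableAt hψ
  have hcoord : ∀ (f : M → H2), MDifferentiableAt (𝓡 2) 𝓘(ℝ, H2) f p → ∀ k,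
      mvfderiv (𝓡 2) f p X k = mvfderiv (𝓡 2) (fun q => f q k) p X := by
    intro f hf k
    have h := (ContinuousLinearMap.proj (R := ℝ) (φ := fun _ : Fin 2 => ℍ[ℝ]) k).hasMFDerivAt
      (x := f p) |>.comp p hf.hasMFDerivAt
    exact (congrArg (fun A => A X) h.mfderiv).symm
  set l : M → ℍ[ℝ] := fun q => (L.frame p q i)⁻¹ * ψ q i with hl
  have hinv : MDifferentiableAt (𝓡 2) 𝓘(ℝ, ℍ[ℝ]) (fun q => (L.frame p q i)⁻¹) p :=
    DifferentiableAt.comp_mdifferentiableAt (g := fun a : ℍ[ℝ] => a⁻¹)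
      (hasFDerivAt_inv' hi).differentiableAt (hφi i)
  have hld : MDifferentiableAt (𝓡 2) 𝓘(ℝ, ℍ[ℝ]) l p := MDifferentiableAt.mul hinv (hψi i)
  have hmem : ∀ q ∈ U, ψ q ∈ L.fiber q → ∀ k, ψ q k = L.frame p q k * l q ∨
      L.frame p q i = 0 := by
    intro q hq hm k
    rw [(hspan q hq).2] at hm
    obtain ⟨a, ha⟩ := Submodule.mem_span_singleton.mp hm
    by_cases h0 : L.frame p q i = 0
    · exact Or.inr h0
    · left
      have h1 : ∀ k, ψ q k = L.frame p q k * a.unop := fun k => (congrFun ha k).symm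
      rw [hl, h1 k]
      simp only [h1 i, inv_mul_cancel_left₀ h0]
  have hval : ψ p = MulOpposite.op (l p) • L.frame p p :=
    funext fun k => (hmem p hp hL.self_of_nhds k).resolve_right hi
  have hder : mvfderiv (𝓡 2) ψ p X = MulOpposite.op (l p) • mvfderiv (𝓡 2) (L.frame p) p X
      + MulOpposite.op (mvfderiv (𝓡 2) l p X) • L.frame p p := by
    funext k
    have hne : ∀ᶠ q in 𝓝 p, L.frame p q i ≠ 0 := (hφi i).continuousAt.eventually_ne hi
    have heq : (fun q => ψ q k) =ᶠ[𝓝 p] (fun q => L.frame p q k) * l := by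
      filter_upwards [hL, hU.mem_nhds hp, hne] with q h1 h2 h3
      exact (hmem q h2 h1 k).resolve_right h3
    have h := ((hφi k).hasMFDerivAt.mul' hld.hasMFDerivAt).congr_of_eventuallyEq heq
    have h' : mvfderiv (𝓡 2) (fun q => ψ q k) p X = L.frame p p k * mvfderiv (𝓡 2) l p X
        + mvfderiv (𝓡 2) (fun q => L.frame p q k) p X * l p :=
      congrArg (fun A => A X) h.mfderiv
    rw [hcoord ψ hψ k, h', add_comm, Pi.add_apply, Pi.smul_apply, Pi.smul_apply,
      hcoord _ hφd k]
    rfl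
  have hc : L.coord p ⟨ψ p, hL.self_of_nhds⟩ = MulOpposite.op (l p) := by
    refine (LinearEquiv.symm_apply_eq _).mpr ?_
    ext1
    exact hval
  have hφm : L.frame p p ∈ L.fiber p := by
    rw [L.fiber_eq p]; exact Submodule.mem_span_singleton_self _
  change L.coord p ⟨ψ p, hL.self_of_nhds⟩ • (L.fiber p).mkQ (mvfderiv (𝓡 2) (L.frame p) p X) = _
  rw [hc, hder, map_add, map_smul, map_smul, show (L.fiber p).mkQ (L.frame p p) = 0 from (Submodule.Quotient.mk_eq_zero _).mpr hφm]
  simp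

end LineSubbundle

variable [IsManifold (𝓡 2) ∞ M] (C : ComplexStructure M) (L : LineSubbundle M)

/-- `L` is a holomorphic curve in `ℍP¹`: there is a complex structure `𝒥` on `L`, i.e. a smooth
section of `End(L)` with `𝒥² = -I`, such that `*δ = δ 𝒥`, where `*δ(X) = δ(J X)`. Smoothness of
`𝒥` means that it maps smooth local sections of `L` to smooth local sections. -/
def IsHolomorphicCurve : Prop :=
  ∃ 𝒥 : (p : M) → Module.End (ℍ[ℝ])ᵐᵒᵖ (L.fiber p),
    (∀ U : Set M, IsOpen U → ∀ ψ : (q : M) → L.fiber q,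
      ContMDiffOn (𝓡 2) 𝓘(ℝ, H2) ∞ (fun q => (ψ q : H2)) U →
      ContMDiffOn (𝓡 2) 𝓘(ℝ, H2) ∞ (fun q => (𝒥 q (ψ q) : H2)) U) ∧
    (∀ p, 𝒥 p * 𝒥 p = -1) ∧
    ∀ p X, L.delta p (C.J p X) = L.delta p X ∘ₗ 𝒥 p

/-- `L` is immersed: its derivative `δ` is injective. -/
def IsImmersed : Prop := ∀ p, Function.Injective (L.delta p)

/-- The differential `dS` of a map `S : M → End(ℍ²)`. -/
def dEnd (S : M → EndH2) (p : M) : TangentSpace (𝓡 2) p →L[ℝ] (H2 →L[ℝ] H2) :=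
  mvfderiv (𝓡 2) (fun q => toReal (S q)) p

/-- `*dS`, where `*ω = ω ∘ J`. -/
def starDEnd (S : M → EndH2) (p : M) : TangentSpace (𝓡 2) p →L[ℝ] (H2 →L[ℝ] H2) :=
  (dEnd S p).comp (C.J p)

/-- The Hopf field `Q = (1/4)(S dS - *dS)` of a complex structure `S` on `H = M × ℍ²`. -/
def hopfQ (S : M → EndH2) (p : M) (X : TangentSpace (𝓡 2) p) : H2 →L[ℝ] H2 :=
  (1 / 4 : ℝ) • ((toReal (S p)).comp (dEnd S p X) - starDEnd C S p X)

/-- `d''ψ = (1/2)(dψ + S *dψ)`, the antilinear part of the differential of `ψ : M → ℍ²`. -/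
def dBar (S : M → EndH2) (ψ : M → H2) (p : M) (X : TangentSpace (𝓡 2) p) : H2 :=
  (1 / 2 : ℝ) • (mvfderiv (𝓡 2) ψ p X + S p (mvfderiv (𝓡 2) ψ p (C.J p X)))

/-- `Q` is the part of `d''` that anticommutes with `S`: one has `d'' = ∂bar + Q` with
`∂bar ψ = (1/2)(d''ψ - S d''(Sψ))`. -/
theorem dBar_eq (S : M → EndH2) (p : M) (X : TangentSpace (𝓡 2) p) (ψ : M → H2)
    (hZ : S p ∈ Z)
    (hS : MDifferentiableAt (𝓡 2) 𝓘(ℝ, H2 →L[ℝ] H2) (fun q => toReal (S q)) p)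
    (hψ : MDifferentiableAt (𝓡 2) 𝓘(ℝ, H2) ψ p) :
    dBar C S ψ p X = (1 / 2 : ℝ) • (dBar C S ψ p X - S p (dBar C S (fun q => S q (ψ q)) p X))
      + hopfQ C S p X (ψ p) := by
  have key : ∀ Y, mvfderiv (𝓡 2) (fun q => S q (ψ q)) p Y
      = dEnd S p Y (ψ p) + S p (mvfderiv (𝓡 2) ψ p Y) := by
    intro Y
    have h1 := hS.hasMFDerivAt
    have h2 := hψ.hasMFDerivAt
    have h : HasMFDerivAt (𝓡 2) 𝓘(ℝ, H2) (fun q => toReal (S q) (ψ q)) p _ :=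
      ⟨h1.1.clm_apply h2.1, by simpa only [mfld_simps] using! h1.2.clm_apply h2.2⟩
    exact (congrArg (fun A => A Y) h.mfderiv).trans (add_comm _ _)
  have hZ' : ∀ v, S p (S p v) = -v := fun v => LinearMap.congr_fun hZ v
  have e : ∀ (r : ℝ) v, S p (r • v) = r • S p v := fun r v => (S p).map_smul_of_tower r v
  have hr : ∀ v, toReal (S p) v = S p v := fun _ => rfl
  have hs : starDEnd C S p X = dEnd S p (C.J p X) := rfl
  simp only [dBar, key, hopfQ, hs, e, map_add, hZ', map_neg, smul_apply, sub_apply,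
    ContinuousLinearMap.comp_apply, hr]
  module

/-- `S` is the mean curvature sphere of `L`: the complex structure `S : M → 𝒵` on `H = M × ℍ²`
with `S L = L`, `dS L ⊆ L`, `*δ = δ ∘ S = S ∘ δ` and `Q|_L = 0`. -/
structure IsMeanCurvatureSphere (S : M → EndH2) : Prop where
  smooth : ContMDiff (𝓡 2) 𝓘(ℝ, H2 →L[ℝ] H2) ∞ (fun q => toReal (S q))
  mem_Z : ∀ p, S p ∈ Z
  map_fiber : ∀ p, (L.fiber p).map (S p) = L.fiber p
  dS_fiber : ∀ p X, ∀ v ∈ L.fiber p, dEnd S p X v ∈ L.fiber p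
  star_delta_eq_delta_comp : ∀ p X, L.delta p (C.J p X) =
    L.delta p X ∘ₗ (S p).restrict (Submodule.map_le_iff_le_comap.mp (map_fiber p).le)
  star_delta_eq_comp_delta : ∀ p X, L.delta p (C.J p X) =
    (L.fiber p).mapQ (L.fiber p) (S p) (Submodule.map_le_iff_le_comap.mp (map_fiber p).le)
      ∘ₗ L.delta p X
  hopfQ_fiber : ∀ p X, ∀ v ∈ L.fiber p, hopfQ C S p X v = 0

end Surface

end QuaternionicCurve

end

/-! Put `B = dS(X)`, `B' = *dS(X)`, and let `A = (1/4)(S dS + *dS)` be the companion of `Q`. The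
image of `A` lies in `L` and `Q` vanishes on `L`, so `Q A = 0`, that is `(B' - S B)(B' + S B) = 0`.
Since `S` anticommutes with `B` and `B'`, the trace of this product gives the equality of lengths,
and the trace of `S` times it gives orthogonality (`trace_conformal`).

The geometric content is that `A` maps into `L` (`IsMeanCurvatureSphere.dEnd_add_mem`). By
immersion, a frame `φ` of `L` and `dφ(X)` span `ℍ²`. On `φ` the claim follows from `S L = L` and `dS
L ⊆ L`. On `dφ(X)` it follows from the symmetry of the second derivative of `S`
(`mkQ_dEnd_sub_dEnd`): modulo `L`, this turns `Q|_L = 0` into a statement about `A`. -/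

namespace QuaternionicCurve

/-! ### Trace algebra and bases of `ℍ²` -/

/-- If `S` anticommutes with `B` and `B'`, `S² = -1` and `(B' - S B) (B' + S B) = 0`, then `B` and
`B'` have equal length and are orthogonal for the form `t (T U)` of any trace `t`. -/
theorem trace_conformal {R : Type*} [Ring R] (t : R →+ ℝ) (ht : ∀ T U, t (T * U) = t (U * T))
    {S B B' : R} (hS : S * S = -1) (hB : S * B = -(B * S))
    (hB' : S * B' = -(B' * S)) (h : (B' - S * B) * (B' + S * B) = 0) :
    t (B * B) = t (B' * B') ∧ t (B * B') = 0 := by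
  have hSS : ∀ T, S * (S * T) = -T := fun T => by rw [← mul_assoc, hS, neg_one_mul]
  -- Anticommutation followed by cyclicity turns `t (S T T)` into its own negative.
  have hanti : ∀ T, S * T = -(T * S) → t (S * (T * T)) = 0 := by
    intro T hT
    have h1 : t (S * (T * T)) = -t (T * S * T) := by
      rw [← mul_assoc, hT, neg_mul, map_neg]
    have h2 : t (T * S * T) = t (S * (T * T)) := by rw [mul_assoc, ht, mul_assoc]
    linarith
  have hSBSB : (S * B) * (S * B) = B * B := by
    rw [mul_assoc, ← mul_assoc B, ← neg_neg (B * S), ← hB, neg_mul, mul_neg, mul_assoc, hSS,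
      neg_neg]
  constructor
  -- The mixed terms `B' S B` and `S B B'` have the same trace, by cyclicity.
  · have h1 : t (B' * B') + t (B' * (S * B)) - t ((S * B) * B') - t (B * B) = 0 := by
      rw [← hSBSB, ← map_add, ← map_sub, ← map_sub, ← map_zero t, ← h]
      congr 1
      noncomm_ring
    linarith [ht B' (S * B)]
  -- Multiplied by `S`, the square terms become traceless by `hanti` and the mixed terms become `B'
  -- B + B B'`.
  · have e : S * (B' * (S * B)) = B' * B := by
      rw [← mul_assoc, hB', neg_mul, mul_assoc, hSS, mul_neg, neg_neg]
    have e' : S * (S * B * (S * B)) = S * (B * B) := by rw [hSBSB]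
    have h1 : t (S * (B' * B')) + t (B' * B) + t (B * B') - t (S * (B * B)) = 0 := by
      rw [← e', ← e, ← neg_neg (B * B'), ← hSS, ← map_add, ← map_add, ← map_sub, ← map_zero t, ← mul_zero S, ← h]
      congr 1
      noncomm_ring
    rw [hanti B hB, hanti B' hB'] at h1
    linarith [ht B' B]

theorem traceForm_conformal {S B B' : H2 →L[ℝ] H2} (hS : S * S = -1) (hB : S * B = -(B * S))
    (hB' : S * B' = -(B' * S)) (h : (B' - S * B) * (B' + S * B) = 0) :
    traceForm B B = traceForm B' B' ∧ traceForm B B' = 0 := by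
  have h := trace_conformal (LinearMap.trace ℝ H2 ∘ₗ ContinuousLinearMap.coeLM ℝ).toAddMonoidHom
    (fun T U : H2 →L[ℝ] H2 => LinearMap.trace_mul_comm ℝ (T : H2 →ₗ[ℝ] H2) (U : H2 →ₗ[ℝ] H2))
    hS hB hB' h
  exact ⟨congrArg (1 / 8 * ·) h.1, (congrArg (1 / 8 * ·) h.2).trans (mul_zero _)⟩

/-- Two vectors of `ℍ²` span it if the first is nonzero and the second is not a multiple of it. -/
theorem exists_eq_smul_add_smul {v w : H2} (hv : v ≠ 0)
    (hw : w ∉ Submodule.span (ℍ[ℝ])ᵐᵒᵖ {v}) (x : H2) :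
    ∃ a b : (ℍ[ℝ])ᵐᵒᵖ, x = a • v + b • w := by
  have e : ℍ[ℝ] ≃ₗ[(ℍ[ℝ])ᵐᵒᵖ] (ℍ[ℝ])ᵐᵒᵖ :=
    { MulOpposite.opAddEquiv with map_smul' := fun _ _ => rfl }
  have : Module.Finite (ℍ[ℝ])ᵐᵒᵖ ℍ[ℝ] := Module.Finite.equiv e.symm
  have hrank : Module.finrank (ℍ[ℝ])ᵐᵒᵖ H2 = 2 := by
    rw [Module.finrank_pi_fintype]
    simp [e.finrank_eq]
  have hli : LinearIndependent (ℍ[ℝ])ᵐᵒᵖ ![v, w] := by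
    rw [LinearIndependent.pair_iff' hv]
    exact fun a ha => hw (Submodule.mem_span_singleton.mpr ⟨a, ha⟩)
  have htop := hli.span_eq_top_of_card_eq_finrank' (by simp [hrank])
  have hx : x ∈ Submodule.span (ℍ[ℝ])ᵐᵒᵖ (Set.range ![v, w]) := htop ▸ Submodule.mem_top
  rw [Matrix.range_cons, Matrix.range_cons, Matrix.range_empty, Set.union_empty,
    Set.singleton_union, Submodule.mem_span_pair] at hx
  obtain ⟨a, b, hab⟩ := hx
  exact ⟨a, b, hab.symm⟩

section Surface

variable {M : Type*} [TopologicalSpace M] [ChartedSpace (EuclideanSpace ℝ (Fin 2)) M]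

/-! ### Constraints on `dS` inherited from `S` -/

/-- A continuous linear map that is constant along `S` annihilates `dS`. -/
theorem clm_dEnd_eq_zero {F : Type*} [NormedAddCommGroup F] [NormedSpace ℝ F] {S : M → EndH2}
    {p : M} (hS : MDifferentiableAt (𝓡 2) 𝓘(ℝ, H2 →L[ℝ] H2) (fun q => toReal (S q)) p)
    (l : (H2 →L[ℝ] H2) →L[ℝ] F) (c : F) (hl : ∀ q, l (toReal (S q)) = c)
    (X : TangentSpace (𝓡 2) p) : l (dEnd S p X) = 0 := by
  have h := (l.hasMFDerivAt (x := toReal (S p))).comp p hS.hasMFDerivAt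
  have hc : l ∘ (fun q => toReal (S q)) = fun _ => c := funext hl
  rw [hc] at h
  exact congrArg (fun A => A X) (h.mfderiv.symm.trans mfderiv_const)

/-- `dS` takes values in the quaternionic linear endomorphisms. -/
theorem dEnd_smul {S : M → EndH2} {p : M}
    (hS : MDifferentiableAt (𝓡 2) 𝓘(ℝ, H2 →L[ℝ] H2) (fun q => toReal (S q)) p)
    (X : TangentSpace (𝓡 2) p) (a : (ℍ[ℝ])ᵐᵒᵖ) (v : H2) :
    dEnd S p X (a • v) = a • dEnd S p X v := by
  set m : H2 →L[ℝ] H2 := LinearMap.toContinuousLinearMap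
    (Module.toModuleEnd ℝ (S := (ℍ[ℝ])ᵐᵒᵖ) H2 a)
  -- The map `T ↦ T (v a) - (T v) a` vanishes on all quaternionic linear `T`, hence along `S`.
  have h := clm_dEnd_eq_zero hS (ContinuousLinearMap.apply ℝ H2 (a • v)
    - m.comp (ContinuousLinearMap.apply ℝ H2 v)) 0
    (fun q => sub_eq_zero.mpr ((S q).map_smul a v)) X
  exact sub_eq_zero.mp h

/-- The derivative of a square root of a constant anticommutes with it. -/
theorem mul_mvfderiv_of_mul_self_eq_const {R : Type*} [NormedRing R] [NormedAlgebra ℝ R] {f : M → R}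
    {p : M} (hf : MDifferentiableAt (𝓡 2) 𝓘(ℝ, R) f p) {c : R} (hc : ∀ q, f q * f q = c)
    (X : TangentSpace (𝓡 2) p) :
    f p * mvfderiv (𝓡 2) f p X = -(mvfderiv (𝓡 2) f p X * f p) := by
  have h := hf.hasMFDerivAt.mul' hf.hasMFDerivAt
  rw [show f * f = fun _ => c from funext hc] at h
  have h0 : f p * mvfderiv (𝓡 2) f p X + mvfderiv (𝓡 2) f p X * f p = 0 :=
    congrArg (fun A => A X) (h.mfderiv.symm.trans mfderiv_const)
  exact eq_neg_of_add_eq_zero_left h0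

/-- If `S² = -I` then `dS` anticommutes with `S`. -/
theorem toReal_mul_dEnd {S : M → EndH2} {p : M}
    (hS : MDifferentiableAt (𝓡 2) 𝓘(ℝ, H2 →L[ℝ] H2) (fun q => toReal (S q)) p)
    (hZ : ∀ q, S q ∈ Z) (X : TangentSpace (𝓡 2) p) :
    toReal (S p) * dEnd S p X = -(dEnd S p X * toReal (S p)) := by
  exact mul_mvfderiv_of_mul_self_eq_const (f := fun q => toReal (S q)) hS (c := -1)
    (fun q => ContinuousLinearMap.ext fun v => LinearMap.congr_fun (hZ q) v) X

/-! ### Second derivatives in a chart -/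

/-- The differential of a map into a normed space, computed in the preferred chart. -/
theorem mvfderiv_eq_fderiv_comp_symm {F : Type*} [NormedAddCommGroup F] [NormedSpace ℝ F]
    {f : M → F} {p : M} (hf : MDifferentiableAt (𝓡 2) 𝓘(ℝ, F) f p) :
    mvfderiv (𝓡 2) f p =
      fderiv ℝ (f ∘ (extChartAt (𝓡 2) p).symm) (extChartAt (𝓡 2) p p) := by
  change mfderiv (𝓡 2) 𝓘(ℝ, F) f p = _
  rw [hf.mfderiv]
  simp only [writtenInExtChartAt, extChartAt_model_space_eq_id, PartialEquiv.refl_coe,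
    Function.id_comp, ModelWithCorners.range_eq_univ, fderivWithin_univ]
  rfl

theorem contDiffAt_comp_extChartAt_symm {F : Type*} [NormedAddCommGroup F] [NormedSpace ℝ F]
    {f : M → F} {p : M} (hf : ContMDiffAt (𝓡 2) 𝓘(ℝ, F) ∞ f p) :
    ContDiffAt ℝ ∞ (f ∘ (extChartAt (𝓡 2) p).symm) (extChartAt (𝓡 2) p p) := by
  have h := (contMDiffAt_iff.mp hf).2
  simpa only [extChartAt_model_space_eq_id, PartialEquiv.refl_coe,
    Function.id_comp, ModelWithCorners.range_eq_univ, contDiffWithinAt_univ] using h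

variable [IsManifold (𝓡 2) ∞ M]

/-- In a chart, the partial derivatives of `f` are values of its differential. -/
theorem exists_mvfderiv_eq_fderiv {F : Type*} [NormedAddCommGroup F] [NormedSpace ℝ F] {f : M → F}
    {p q : M} (hf : MDifferentiableAt (𝓡 2) 𝓘(ℝ, F) f q)
    (hq : q ∈ (extChartAt (𝓡 2) p).source) (u : EuclideanSpace ℝ (Fin 2)) :
    ∃ Y : TangentSpace (𝓡 2) q, mvfderiv (𝓡 2) f q Y =
      fderiv ℝ (f ∘ (extChartAt (𝓡 2) p).symm) (extChartAt (𝓡 2) p q) u := by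
  have hy := (extChartAt (𝓡 2) p).map_source hq
  have h1 : MDifferentiableAt 𝓘(ℝ, EuclideanSpace ℝ (Fin 2)) (𝓡 2) (extChartAt (𝓡 2) p).symm
      (extChartAt (𝓡 2) p q) :=
    ((contMDiffOn_extChartAt_symm (n := ∞) p).contMDiffAt
      ((isOpen_extChartAt_target p).mem_nhds hy)).mdifferentiableAt (by simp)
  have hl := (extChartAt (𝓡 2) p).left_inv hq
  have h2 := hl.symm ▸ hf
  have h := mfderiv_comp (extChartAt (𝓡 2) p q) h2 h1
  rw [mfderiv_eq_fderiv] at h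
  rw [h, hl]
  exact ⟨_, rfl⟩

/-- In a chart around `p`, the partial derivatives of `f` applied to `φ` are sections whose
derivatives at `p` involve the symmetric second derivative of `f`. -/
theorem exists_symm_second_derivative {V W : Type*} [NormedAddCommGroup V] [NormedSpace ℝ V]
    [NormedAddCommGroup W] [NormedSpace ℝ W] {f : M → V →L[ℝ] W}
    (hf : ContMDiff (𝓡 2) 𝓘(ℝ, V →L[ℝ] W) ∞ f) {p : M} {φ : M → V}
    (hφ : ContMDiffAt (𝓡 2) 𝓘(ℝ, V) ∞ φ p) :
    ∃ D : TangentSpace (𝓡 2) p → TangentSpace (𝓡 2) p → W, (∀ a b, D a b = D b a) ∧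
      ∀ a b : TangentSpace (𝓡 2) p, ∃ ψ : M → W, MDifferentiableAt (𝓡 2) 𝓘(ℝ, W) ψ p ∧
        ψ p = mvfderiv (𝓡 2) f p a (φ p) ∧
        (∀ᶠ q in 𝓝 p, ∃ Y, ψ q = mvfderiv (𝓡 2) f q Y (φ q)) ∧
        mvfderiv (𝓡 2) ψ p b = D b a + mvfderiv (𝓡 2) f p a (mvfderiv (𝓡 2) φ p b) := by
  set c := extChartAt (𝓡 2) p with hc
  set F : EuclideanSpace ℝ (Fin 2) → (V →L[ℝ] W) := f ∘ c.symm with hF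
  have hFs : ContDiffAt ℝ ∞ F (c p) := contDiffAt_comp_extChartAt_symm (hf p)
  have hφs : ContDiffAt ℝ ∞ (φ ∘ c.symm) (c p) := contDiffAt_comp_extChartAt_symm hφ
  have htwo : (2 : WithTop ℕ∞) ≤ ∞ :=
    WithTop.coe_le_coe.mpr (le_top : (2 : ℕ∞) ≤ ⊤)
  have hF' : DifferentiableAt ℝ (fderiv ℝ F) (c p) :=
    (hFs.fderiv_right (m := 1) (by exact_mod_cast htwo)).differentiableAt (by simp)
  have hdf : mvfderiv (𝓡 2) f p = fderiv ℝ F (c p) :=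
    mvfderiv_eq_fderiv_comp_symm ((hf p).mdifferentiableAt (by simp))
  have hdφ : mvfderiv (𝓡 2) φ p = fderiv ℝ (φ ∘ c.symm) (c p) :=
    mvfderiv_eq_fderiv_comp_symm (hφ.mdifferentiableAt (by simp))
  have hsymm : IsSymmSndFDerivAt ℝ F (c p) :=
    hFs.isSymmSndFDerivAt (by simpa using htwo)
  -- `D` is the Hessian of `f` in the chart, applied to `φ p`. It depends on the chart, but only its
  -- symmetry matters.
  refine ⟨fun b a => fderiv ℝ (fderiv ℝ F) (c p) b a (φ p),
    fun a b => congrArg (fun A : V →L[ℝ] W => A (φ p)) (hsymm a b), fun a b => ?_⟩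
  have hcs : ContMDiffAt (𝓡 2) 𝓘(ℝ, EuclideanSpace ℝ (Fin 2)) ∞ c p := contMDiffAt_extChartAt
  have hg : MDifferentiableAt (𝓡 2) 𝓘(ℝ, V →L[ℝ] W) (fun q => fderiv ℝ F (c q) a) p :=
    DifferentiableAt.comp_mdifferentiableAt (g := fun x => fderiv ℝ F x a)
      (hF'.clm_apply (differentiableAt_const a)) (hcs.mdifferentiableAt (by simp))
  have h1 := hg.hasMFDerivAt
  have h2 := (hφ.mdifferentiableAt (by simp)).hasMFDerivAt
  have h : HasMFDerivAt (𝓡 2) 𝓘(ℝ, W) (fun q => fderiv ℝ F (c q) a (φ q)) p _ :=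
    ⟨h1.1.clm_apply h2.1, by simpa only [mfld_simps] using! h1.2.clm_apply h2.2⟩
  -- The direction `a` is extended as a constant vector in the chart.
  refine ⟨fun q => fderiv ℝ F (c q) a (φ q), h.mdifferentiableAt, by rw [hdf]; rfl, ?_, ?_⟩
  · filter_upwards [extChartAt_source_mem_nhds (I := 𝓡 2) p] with q hq
    obtain ⟨Y, hY⟩ := exists_mvfderiv_eq_fderiv ((hf q).mdifferentiableAt (by simp)) hq a
    exact ⟨Y, by rw [hY]⟩
  · rw [mvfderiv_eq_fderiv_comp_symm h.mdifferentiableAt, hdf, hdφ]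
    have heq : (fun q => fderiv ℝ F (c q) a (φ q)) ∘ c.symm =ᶠ[𝓝 (c p)]
        fun x => fderiv ℝ F x a ((φ ∘ c.symm) x) := by
      filter_upwards [extChartAt_target_mem_nhds (I := 𝓡 2) p] with x hx
      simp only [Function.comp_apply]
      rw [c.right_inv hx]
    have hA := (hF'.hasFDerivAt.clm_apply (hasFDerivAt_const a (c p))).clm_apply
      (hφs.differentiableAt (by simp)).hasFDerivAt
    have hcp : (φ ∘ c.symm) (c p) = φ p := congrArg φ (extChartAt_to_inv p)
    rw [heq.fderiv_eq, hA.fderiv, hcp]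
    change fderiv ℝ F (c p) a (fderiv ℝ (φ ∘ c.symm) (c p) b) +
      (fderiv ℝ F (c p) 0 + fderiv ℝ (fderiv ℝ F) (c p) b a) (φ p) = _
    rw [map_zero, zero_add, add_comm]
    rfl

/-! ### The image of the Hopf field `A` -/

/-- The symmetry of the second derivative of `S`, read modulo `L` along a section `φ` of `L`. -/
theorem mkQ_dEnd_sub_dEnd {L : LineSubbundle M} {S : M → EndH2}
    (hS : ContMDiff (𝓡 2) 𝓘(ℝ, H2 →L[ℝ] H2) ∞ (fun q => toReal (S q)))
    (hL : ∀ q X, ∀ v ∈ L.fiber q, dEnd S q X v ∈ L.fiber q) {p : M} {φ : M → H2}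
    (hφ : ContMDiffAt (𝓡 2) 𝓘(ℝ, H2) ∞ φ p) (hφL : ∀ᶠ q in 𝓝 p, φ q ∈ L.fiber q)
    (u v : TangentSpace (𝓡 2) p) :
    (L.fiber p).mkQ (dEnd S p u (mvfderiv (𝓡 2) φ p v) - dEnd S p v (mvfderiv (𝓡 2) φ p u)) =
      L.delta p v ⟨dEnd S p u (φ p), hL p u _ hφL.self_of_nhds⟩
        - L.delta p u ⟨dEnd S p v (φ p), hL p v _ hφL.self_of_nhds⟩ := by
  obtain ⟨D, hD, hψ⟩ := exists_symm_second_derivative hS hφ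
  -- `dS(a) φ`, with `a` constant in the chart, is again a section of `L`, so `δ` computes its
  -- derivative modulo `L`.
  have key : ∀ a b, L.delta p b ⟨dEnd S p a (φ p), hL p a _ hφL.self_of_nhds⟩ =
      (L.fiber p).mkQ (D b a + dEnd S p a (mvfderiv (𝓡 2) φ p b)) := by
    intro a b
    obtain ⟨ψ, hψd, hψp, hψY, hder⟩ := hψ a b
    have hψL : ∀ᶠ q in 𝓝 p, ψ q ∈ L.fiber q := by
      filter_upwards [hφL, hψY] with q hq ⟨Y, hY⟩
      rw [hY]
      exact hL q Y _ hq
    have hd := L.delta_apply p b ψ hψd hψL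
    rw [hder] at hd
    refine Eq.trans ?_ hd
    congr 1
    exact Subtype.ext hψp.symm
  rw [key, key, hD u v, ← map_sub, add_sub_add_left_eq_sub]

/-- On `L` one has `*dS = S dS`. -/
theorem IsMeanCurvatureSphere.starDEnd_apply {C : ComplexStructure M} {L : LineSubbundle M}
    {S : M → EndH2} (hS : IsMeanCurvatureSphere C L S) {p : M} {v : H2} (hv : v ∈ L.fiber p)
    (X : TangentSpace (𝓡 2) p) : dEnd S p (C.J p X) v = S p (dEnd S p X v) := by
  have h : (1 / 4 : ℝ) • (S p (dEnd S p X v) - dEnd S p (C.J p X) v) = 0 :=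
    hS.hopfQ_fiber p X v hv
  exact (sub_eq_zero.mp ((smul_eq_zero.mp h).resolve_left (by norm_num))).symm

/-- The Hopf field `A = (1/4)(S dS + *dS)` of the mean curvature sphere takes values in `L`. -/
theorem IsMeanCurvatureSphere.dEnd_add_mem {C : ComplexStructure M} {L : LineSubbundle M}
    {S : M → EndH2} (hS : IsMeanCurvatureSphere C L S) (himm : IsImmersed L) {p : M}
    {X : TangentSpace (𝓡 2) p} (hX : X ≠ 0) (w : H2) :
    dEnd S p (C.J p X) w + S p (dEnd S p X w) ∈ L.fiber p := by
  obtain ⟨U, hU, hp, hφU, hspan⟩ := L.frame_spec p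
  set φ := L.frame p with hφdef
  have hφ : ContMDiffAt (𝓡 2) 𝓘(ℝ, H2) ∞ φ p := hφU.contMDiffAt (hU.mem_nhds hp)
  have hφL : ∀ᶠ q in 𝓝 p, φ q ∈ L.fiber q := by
    filter_upwards [hU.mem_nhds hp] with q hq
    rw [(hspan q hq).2]
    exact Submodule.mem_span_singleton_self _
  have hφp : φ p ∈ L.fiber p := hφL.self_of_nhds
  have hSd : MDifferentiableAt (𝓡 2) 𝓘(ℝ, H2 →L[ℝ] H2) (fun q => toReal (S q)) p :=
    (hS.smooth p).mdifferentiableAt (by simp)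
  have hSL : ∀ v ∈ L.fiber p, S p v ∈ L.fiber p :=
    Submodule.map_le_iff_le_comap.mp (hS.map_fiber p).le
  have hQ : dEnd S p (C.J p X) (φ p) = S p (dEnd S p X (φ p)) := by
    exact hS.starDEnd_apply hφp X
  have hd : ∀ Y, L.delta p Y ⟨φ p, hφp⟩ = (L.fiber p).mkQ (mvfderiv (𝓡 2) φ p Y) := fun Y =>
    L.delta_apply p Y φ (hφ.mdifferentiableAt (by simp)) hφL
  set φX := mvfderiv (𝓡 2) φ p X with hφX
  -- `δ(X)` is determined by its value on `φ p`; `dφ(X) ∈ L` would force `δ(X) = 0`.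
  have hnot : φX ∉ L.fiber p := by
    intro hmem
    refine hX (himm p ?_)
    rw [map_zero]
    ext ⟨v, hv⟩
    obtain ⟨a, rfl⟩ := Submodule.mem_span_singleton.mp ((hspan p hp).2 ▸ hv)
    have h0 : L.delta p X ⟨φ p, hφp⟩ = 0 := by
      rw [hd]
      exact (Submodule.Quotient.mk_eq_zero _).mpr hmem
    have := (L.delta p X).map_smul a ⟨φ p, hφp⟩
    rw [h0, smul_zero] at this
    exact this
  have hJφ : mvfderiv (𝓡 2) φ p (C.J p X) - S p φX ∈ L.fiber p := by
    rw [← Submodule.Quotient.eq]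
    have h := LinearMap.congr_fun (hS.star_delta_eq_comp_delta p X) ⟨φ p, hφp⟩
    rw [LinearMap.comp_apply, hd, hd] at h
    exact h
  -- With `*δ = δ S`, the right side of `mkQ_dEnd_sub_dEnd` for `X`, `J X` is `δ(X)` of `S dS(X) φ -
  -- *dS(X) φ`, zero by `hQ`. On the left, `dφ(J X)` may be replaced by `S dφ(X)` modulo `L`, and
  -- `S` anticommutes with `dS(X)`.
  have hA : dEnd S p (C.J p X) φX + S p (dEnd S p X φX) ∈ L.fiber p := by
    have h := mkQ_dEnd_sub_dEnd hS.smooth hS.dS_fiber hφ hφL X (C.J p X)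
    rw [hS.star_delta_eq_delta_comp p X, LinearMap.comp_apply, ← map_sub,
      show (S p).restrict (Submodule.map_le_iff_le_comap.mp (hS.map_fiber p).le)
        ⟨dEnd S p X (φ p), hS.dS_fiber p X _ hφp⟩ - ⟨dEnd S p (C.J p X) (φ p),
          hS.dS_fiber p _ _ hφp⟩ = 0 from Subtype.ext (sub_eq_zero.mpr hQ.symm), map_zero] at h
    have h1 := (Submodule.Quotient.mk_eq_zero _).mp h
    have h2 := hS.dS_fiber p X _ hJφ
    have hanti : S p (dEnd S p X φX) = -dEnd S p X (S p φX) :=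
      congrArg (fun A : H2 →L[ℝ] H2 => A φX) (toReal_mul_dEnd hSd hS.mem_Z X)
    rw [map_sub] at h2
    rw [hanti]
    convert (L.fiber p).sub_mem h2 h1 using 1
    abel
  obtain ⟨a, b, rfl⟩ := exists_eq_smul_add_smul (L.frame_ne p) ((hspan p hp).2 ▸ hnot) w
  rw [map_add, map_add, map_add, dEnd_smul hSd, dEnd_smul hSd, dEnd_smul hSd, dEnd_smul hSd,
    map_smul, map_smul, add_add_add_comm, ← smul_add, ← smul_add]
  exact (L.fiber p).add_mem ((L.fiber p).smul_mem a ((L.fiber p).add_mem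
    (hS.dS_fiber p _ _ hφp) (hSL _ (hS.dS_fiber p _ _ hφp)))) ((L.fiber p).smul_mem b hA)

end Surface

end QuaternionicCurve

open QuaternionicCurve in
theorem mainTheorem11 {M : Type*} [TopologicalSpace M]
    [ChartedSpace (EuclideanSpace ℝ (Fin 2)) M] [IsManifold (𝓡 2) ∞ M]
    (C : ComplexStructure M) (L : LineSubbundle M)
    (hhol : IsHolomorphicCurve C L) (himm : IsImmersed L)
    (S : M → EndH2) (hS : IsMeanCurvatureSphere C L S) (p : M) (X : TangentSpace (𝓡 2) p) :
    traceForm (dEnd S p X) (dEnd S p X) = traceForm (starDEnd C S p X) (starDEnd C S p X) ∧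
      traceForm (dEnd S p X) (starDEnd C S p X) = 0 := by
  have hSd : MDifferentiableAt (𝓡 2) 𝓘(ℝ, H2 →L[ℝ] H2) (fun q => toReal (S q)) p :=
    (hS.smooth p).mdifferentiableAt (by simp)
  refine traceForm_conformal (S := toReal (S p))
    (ContinuousLinearMap.ext fun v => LinearMap.congr_fun (hS.mem_Z p) v)
    (toReal_mul_dEnd hSd hS.mem_Z X) (toReal_mul_dEnd hSd hS.mem_Z (C.J p X)) ?_
  by_cases hX : X = 0
  · subst hX
    simp
  · ext1 w
    -- The inner factor lands in `L`, where `*dS = S dS` makes the outer factor vanish.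
    exact sub_eq_zero.mpr (hS.starDEnd_apply (hS.dEnd_add_mem himm hX w) X)
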